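/- Let $(\mathcal X,\mathrm{dist})$ be a metric space. For a finite set $S\subseteq\mathcal X$ with at least two points let $\mathrm{div}(S)=\sum_{p\in S}\min_{q\in S\setminus\{p\}}\mathrm{dist}(p,q)$ (the sum of nearest-neighbor distances). Let $m$ be the number of colors, let $k_1,\dots,k_m\ge 0$ be integers, and let $k=\sum_i k_i\ge 2$. For pairwise disjoint finite sets $P_1,\dots,P_m\subseteq\mathcal X$ (the color classes) with $|P_i|\ge k_i$, let $$\mathrm{div}_{k_1,\dots,k_m}(P_1,\dots,P_m)=\max\Big\{\mathrm{div}\Big(\bigcup_i S_i\Big): S_i\subseteq P_i,\ |S_i|=k_i\text{ for all } i\Big\}.$$ For a finite set $Q$, GMM$(Q,t)$ is the greedy algorithm that starts from an arbitrary point of $Q$ and then, $t-1$ times, adds to the current set $G$ a point of $Q$ that maximizes $\mathrm{dist}(\cdot,G)=\min_{x\in G}\mathrm{dist}(\cdot,x)$, ties being broken arbitrarily; it returns the set $G$ (and it returns $\emptyset$ if $Q=\emptyset$). Let $\mathcal A$ be the following algorithm: on a finite set $Q$ and with parameter $k$, start with $S=\emptyset$ and repeat $k$ times: compute $G=$ GMM$(Q,k+1)$,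 replace $S$ by $S\cup G$, and replace $Q$ by $Q\setminus G$. Finally return $S$. Theorem. There is an absolute constant $C>0$ such that, for all $\mathcal X$, $m$, $k_1,\dots,k_m$ as above, $\mathcal A$ with parameter $k$ constructs a $C\,m\log k$-approximate color-abiding composable core-set of size at most $C k^2$ per color. That is, on every finite set $\mathcal A$ has an output, every possible output is a subset of the input and has at most $Ck^2$ points, and for all pairwise disjoint finite $P_1,\dots,P_m\subseteq\mathcal X$ with $|P_i|\ge k_i$ and all possible outputs $T_i$ of $\mathcal A$ on $P_i$ (each computed from $P_i$ and $k$ only), $|T_i|\ge k_i$ for all $i$ and $$\mathrm{div}_{k_1,\dots,k_m}(T_1,\dots,T_m)\ \ge\ \frac{1}{C\,m\log k}\ \mathrm{div}_{k_1,\dots,k_m}(P_1,\dots,P_m).$$ -/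

import Mathlib

open Finset

/-- `GMMRun P t G`: the set `G` is a possible output of the greedy (farthest-point) algorithm GMM
run for `t` steps on the point set `P`.  The first point is arbitrary and ties in the choice of a
farthest point are broken arbitrarily, so this is a relation.  `Metric.infDist q G` is
`min_{x ∈ G} dist q x` (here `G` is finite and nonempty).  If `P` has fewer than `t` points, then
once `P` is exhausted the farthest point is one already chosen and the set does not change; on an
empty point set there is nothing to choose and the output is empty. -/
inductive GMMRun {X : Type*} [MetricSpace X] [DecidableEq X] (P : Finset X) :
    ℕ → Finset X → Prop
  | nothing (t : ℕ) (hP : P = ∅) : GMMRun P t ∅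
  | first (p : X) (hp : p ∈ P) : GMMRun P 1 {p}
  | next (t : ℕ) (G : Finset X) (p : X) (hG : GMMRun P t G) (hp : p ∈ P)
      (hmax : ∀ q ∈ P, Metric.infDist q (G : Set X) ≤ Metric.infDist p (G : Set X)) :
      GMMRun P (t + 1) (insert p G)

/-- `RepeatedGMM k P j S Q`: after `j` rounds of the core-set algorithm on `P` with parameter `k`,
the points collected so far can be `S`, the points still available being `Q`.  Each round runs GMM
for `k + 1` steps on the available points, stores its output and removes it. -/
inductive RepeatedGMM {X : Type*} [MetricSpace X] [DecidableEq X] (k : ℕ) (P : Finset X) :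
    ℕ → Finset X → Finset X → Prop
  | start : RepeatedGMM k P 0 ∅ P
  | round (j : ℕ) (S Q G : Finset X) (h : RepeatedGMM k P j S Q) (hG : GMMRun Q (k + 1) G) :
      RepeatedGMM k P (j + 1) (S ∪ G) (Q \ G)

/-- `T` is a possible output of the Sum-NN core-set algorithm on the point set `P` with
parameter `k`: it collects the points found in `k` rounds. -/
def SumNNCoresetAlg {X : Type*} [MetricSpace X] [DecidableEq X] (k : ℕ) (P T : Finset X) : Prop :=
  ∃ Q, RepeatedGMM k P k T Q

/-- Sum of nearest-neighbor distances, `∑_{p ∈ S} min_{q ∈ S \ {p}} dist p q`. -/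
noncomputable def sumNN {X : Type*} [MetricSpace X] [DecidableEq X] (S : Finset X) : ℝ :=
  ∑ p ∈ S, Metric.infDist p (S.erase p : Set X)

/-- `S` picks exactly `κ i` points of each color `i` from the colored point set `P`. -/
def IsFairSelection {X : Type*} {m : ℕ} (κ : Fin m → ℕ) (P S : Fin m → Finset X) : Prop :=
  ∀ i, S i ⊆ P i ∧ #(S i) = κ i

/-- The optimal value of fair diversity maximization under Sum-NN (a maximum as soon as a
fair selection exists, see `isGreatest_fairDiv`). -/
noncomputable def fairDiv {X : Type*} [MetricSpace X] [DecidableEq X] {m : ℕ}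
    (κ : Fin m → ℕ) (P : Fin m → Finset X) : ℝ :=
  sSup {v : ℝ | ∃ S : Fin m → Finset X, IsFairSelection κ P S ∧ v = sumNN (univ.biUnion S)}

theorem isGreatest_fairDiv {X : Type*} [MetricSpace X] [DecidableEq X] {m : ℕ}
    (κ : Fin m → ℕ) (P : Fin m → Finset X) (hP : ∀ i, κ i ≤ #(P i)) :
    IsGreatest {v : ℝ | ∃ S : Fin m → Finset X,
      IsFairSelection κ P S ∧ v = sumNN (univ.biUnion S)} (fairDiv κ P) := by
  have hfin : {v : ℝ | ∃ S : Fin m → Finset X,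
      IsFairSelection κ P S ∧ v = sumNN (univ.biUnion S)}.Finite := by
    refine ((Fintype.piFinset fun i => (P i).powerset).finite_toSet.image
      (fun S => sumNN (univ.biUnion S))).subset ?_
    rintro v ⟨S, hS, rfl⟩
    refine ⟨S, ?_, rfl⟩
    simp only [Finset.mem_coe, Fintype.mem_piFinset, Finset.mem_powerset]
    exact fun i => (hS i).1
  have hne : {v : ℝ | ∃ S : Fin m → Finset X,
      IsFairSelection κ P S ∧ v = sumNN (univ.biUnion S)}.Nonempty := by
    choose S hS using fun i => Finset.exists_subset_card_eq (hP i)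
    exact ⟨_, S, hS, rfl⟩
  exact ⟨hne.csSup_mem hfin, fun v hv => le_csSup hfin.bddAbove hv⟩

/-- The (possibly nondeterministic) summarization algorithm `A`, where `A Q T` says that `T` is a
possible output on the input `Q`, constructs an `α`-approximate color-abiding composable core-set
for the demands `κ`: it always has an output, which is a subset of the input, and whenever it is
run on each color class separately, whatever its outputs `T i` are, their union still has a fair
selection and its optimal fair diversity is at least `1 / α` times that of the whole data. -/
structure IsColorAbidingComposableCoreset {X : Type*} [MetricSpace X] [DecidableEq X] {m : ℕ}
    (A : Finset X → Finset X → Prop) (κ : Fin m → ℕ) (α : ℝ) : Prop where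
  exists_output : ∀ Q, ∃ T, A Q T
  output_subset : ∀ Q T, A Q T → T ⊆ Q
  approx : ∀ P : Fin m → Finset X, Pairwise (fun i j => Disjoint (P i) (P j)) →
    (∀ i, κ i ≤ #(P i)) → ∀ T : Fin m → Finset X, (∀ i, A (P i) (T i)) →
      (∀ i, κ i ≤ #(T i)) ∧ 1 / α * fairDiv κ P ≤ fairDiv κ T

section GMM

variable {X : Type*} [MetricSpace X] [DecidableEq X]

theorem GMMRun.subset {P G : Finset X} {t : ℕ} (h : GMMRun P t G) : G ⊆ P := by
  induction h with
  | nothing t hP => exact empty_subset _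
  | first p hp => simpa using hp
  | next t G p hG hp hmax ih => exact insert_subset hp ih

theorem GMMRun.card_le {P G : Finset X} {t : ℕ} (h : GMMRun P t G) : #G ≤ t := by
  induction h with
  | nothing t hP => simp
  | first p hp => simp
  | next t G p hG hp hmax ih => exact (card_insert_le _ _).trans (by omega)

theorem GMMRun.nonempty {P G : Finset X} {t : ℕ} (h : GMMRun P t G) (hP : P.Nonempty) :
    G.Nonempty := by
  cases h with
  | nothing t h => simp [h] at hP
  | first p hp => simp
  | next t G p hG hp hmax => exact insert_nonempty _ _

theorem exists_gmmRun (P : Finset X) (t : ℕ) : ∃ G, GMMRun P (t + 1) G := by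
  rcases P.eq_empty_or_nonempty with rfl | hP
  · exact ⟨∅, .nothing _ rfl⟩
  induction t with
  | zero =>
    obtain ⟨p, hp⟩ := hP
    exact ⟨{p}, .first p hp⟩
  | succ t ih =>
    obtain ⟨G, hG⟩ := ih
    obtain ⟨p, hp, hmax⟩ := P.exists_max_image (fun q => Metric.infDist q (G : Set X)) hP
    exact ⟨_, .next _ G p hG hp hmax⟩

/-- The output of GMM is either a covering at scale `δ` or a packing at scale `δ`. -/
theorem GMMRun.covering_or_packing {P G : Finset X} {t : ℕ} (h : GMMRun P t G) {δ : ℝ}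
    (hδ : 0 < δ) :
    (∀ q ∈ P, ∃ g ∈ G, dist q g < δ) ∨
      (#G = t ∧ ∀ x ∈ G, ∀ y ∈ G, x ≠ y → δ ≤ dist x y) := by
  induction h with
  | nothing t hP => simp [hP]
  | first p hp => right; simp
  | next t G p hG hp hmax ih =>
    by_cases hcov : ∀ q ∈ P, ∃ g ∈ G, dist q g < δ
    · left
      intro q hq
      obtain ⟨g, hg, hd⟩ := hcov q hq
      exact ⟨g, mem_insert_of_mem hg, hd⟩
    · right
      obtain ⟨hcard, hsep⟩ := ih.resolve_left hcov
      push Not at hcov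
      obtain ⟨q, hq, hfar⟩ := hcov
      have hne : (G : Set X).Nonempty := by exact_mod_cast hG.nonempty ⟨p, hp⟩
      have hp' : δ ≤ Metric.infDist p (G : Set X) :=
        ((Metric.le_infDist hne).2 fun {y} hy => hfar y (by simpa using hy)).trans
          (hmax q hq)
      have hpd : ∀ y ∈ G, δ ≤ dist p y := fun y hy =>
        hp'.trans (Metric.infDist_le_dist_of_mem (by simpa using hy))
      have hpG : p ∉ G := fun hmem => by
        have := hpd p hmem
        rw [dist_self] at this
        linarith
      refine ⟨by rw [card_insert_of_notMem hpG, hcard], ?_⟩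
      intro x hx y hy hxy
      rcases mem_insert.1 hx with rfl | hxG <;> rcases mem_insert.1 hy with rfl | hyG
      · exact absurd rfl hxy
      · exact hpd y hyG
      · rw [dist_comm]; exact hpd x hxG
      · exact hsep x hxG y hyG hxy

end GMM

section Repeated

variable {X : Type*} [MetricSpace X] [DecidableEq X]

theorem exists_repeatedGMM (k : ℕ) (P : Finset X) (j : ℕ) : ∃ S Q, RepeatedGMM k P j S Q := by
  induction j with
  | zero => exact ⟨_, _, .start⟩
  | succ j ih =>
    obtain ⟨S, Q, h⟩ := ih
    obtain ⟨G, hG⟩ := exists_gmmRun Q k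
    exact ⟨_, _, .round j S Q G h hG⟩

theorem RepeatedGMM.union_eq {k j : ℕ} {P S Q : Finset X} (h : RepeatedGMM k P j S Q) :
    S ∪ Q = P := by
  induction h with
  | start => simp
  | round j S Q G h hG ih =>
    rw [union_assoc, union_sdiff_of_subset hG.subset, ih]

theorem RepeatedGMM.disjoint {k j : ℕ} {P S Q : Finset X} (h : RepeatedGMM k P j S Q) :
    Disjoint S Q := by
  induction h with
  | start => simp
  | round j S Q G h hG ih =>
    exact disjoint_union_left.2 ⟨ih.mono_right sdiff_subset, disjoint_sdiff⟩

theorem RepeatedGMM.card_le {k j : ℕ} {P S Q : Finset X} (h : RepeatedGMM k P j S Q) :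
    #S ≤ j * (k + 1) := by
  induction h with
  | start => simp
  | round j S Q G h hG ih =>
    have := hG.card_le
    have := card_union_le S G
    rw [add_mul, one_mul]
    omega

/-- `T` contains more than `k` points with pairwise distances at least `δ`. -/
def HasPacking (k : ℕ) (δ : ℝ) (T : Finset X) : Prop :=
  ∃ G ⊆ T, #G = k + 1 ∧ ∀ x ∈ G, ∀ y ∈ G, x ≠ y → δ ≤ dist x y

/-- If no packing was collected, each of the points left over has one collected point near it
from every round. -/
theorem RepeatedGMM.hasPacking_or_le_card {k j : ℕ} {P S Q : Finset X}
    (h : RepeatedGMM k P j S Q) {δ : ℝ} (hδ : 0 < δ) :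
    HasPacking k δ S ∨ ∀ q ∈ Q, j ≤ #{s ∈ S | dist q s < δ} := by
  induction h with
  | start => simp
  | round j S Q G h hG ih =>
    rcases ih with ⟨H, hH, hH'⟩ | ih
    · exact .inl ⟨H, hH.trans subset_union_left, hH'⟩
    rcases hG.covering_or_packing hδ with hcov | hpack
    · right
      intro q hq
      have hqQ := (mem_sdiff.1 hq).1
      obtain ⟨g, hg, hd⟩ := hcov q hqQ
      have hgS : g ∉ S := fun hgS => disjoint_left.1 h.disjoint hgS (hG.subset hg)
      calc j + 1 ≤ #{s ∈ S | dist q s < δ} + 1 := by have := ih q hqQ; omega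
        _ = #(insert g {s ∈ S | dist q s < δ}) := by
          rw [card_insert_of_notMem (by simp [hgS])]
        _ ≤ _ := by
          refine card_le_card (insert_subset (by simp [hg, hd]) ?_)
          exact filter_subset_filter _ subset_union_left
    · exact .inl ⟨G, subset_union_right, hpack⟩

/-- If the core-set `T` contains no `δ`-packing, small subsets of the data can be moved
injectively into `T` by less than `δ`. -/
theorem SumNNCoresetAlg.hasPacking_or_exists_injOn {k : ℕ} {P T : Finset X}
    (h : SumNNCoresetAlg k P T) {δ : ℝ} (hδ : 0 < δ) :
    HasPacking k δ T ∨ ∀ O ⊆ P, #O ≤ k →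
      ∃ f : X → X, Set.InjOn f O ∧ ∀ p ∈ O, f p ∈ T ∧ dist p (f p) < δ := by
  obtain ⟨Q, hQ⟩ := h
  refine (hQ.hasPacking_or_le_card hδ).imp_right fun hnear O hOP hOk => ?_
  let N : O → Finset X := fun p => if (p : X) ∈ T then {(p : X)} else {s ∈ T | dist (p : X) s < δ}
  have hall : ∀ s : Finset O, #s ≤ #(s.biUnion N) := by
    intro s
    by_cases hs : ∀ p ∈ s, (p : X) ∈ T
    · have hsub : s.map (Function.Embedding.subtype _) ⊆ s.biUnion N := by
        intro x hx
        obtain ⟨p, hp, rfl⟩ := mem_map.1 hx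
        refine mem_biUnion.2 ⟨p, hp, ?_⟩
        simp [N, hs p hp]
      simpa using card_le_card hsub
    · push Not at hs
      obtain ⟨p, hp, hpT⟩ := hs
      have hpQ : (p : X) ∈ Q := by
        have := hOP p.2
        rw [← hQ.union_eq] at this
        exact (mem_union.1 this).resolve_left hpT
      calc #s ≤ Fintype.card O := card_le_univ s
        _ ≤ k := by simpa using hOk
        _ ≤ #(N p) := by simpa [N, hpT] using hnear p hpQ
        _ ≤ _ := card_le_card (subset_biUnion_of_mem N hp)
  obtain ⟨f, hf, hfN⟩ := (all_card_le_biUnion_card_iff_exists_injective N).1 hall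
  refine ⟨fun x => if hx : x ∈ O then f ⟨x, hx⟩ else x, ?_, ?_⟩
  · intro x hx y hy hxy
    have hx' : x ∈ O := hx
    have hy' : y ∈ O := hy
    simp only [hx', hy', dif_pos] at hxy
    exact congrArg Subtype.val (hf hxy)
  · intro p hp
    have := hfN ⟨p, hp⟩
    simp only [hp, dif_pos]
    by_cases hpT : p ∈ T
    · have heq : f ⟨p, hp⟩ = p := by simpa [N, hpT] using this
      rw [heq]
      exact ⟨hpT, by simpa using hδ⟩
    · simpa [N, hpT] using this

theorem SumNNCoresetAlg.subset {k : ℕ} {P T : Finset X} (h : SumNNCoresetAlg k P T) : T ⊆ P := by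
  obtain ⟨Q, hQ⟩ := h
  rw [← hQ.union_eq]
  exact subset_union_left

theorem SumNNCoresetAlg.le_card {k n : ℕ} {P T : Finset X} (h : SumNNCoresetAlg k P T)
    (hnk : n ≤ k) (hn : n ≤ #P) : n ≤ #T := by
  rcases h.hasPacking_or_exists_injOn one_pos with ⟨G, hG, hcard, -⟩ | hinj
  · have := card_le_card hG
    omega
  · obtain ⟨O, hO, rfl⟩ := exists_subset_card_eq hn
    obtain ⟨f, hf, hfT⟩ := hinj O hO hnk
    exact card_le_card_of_injOn f (fun p hp => (hfT p hp).1) hf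

end Repeated

section Selection

variable {X : Type*} [MetricSpace X] [DecidableEq X]

/-- Every point of `A` is close to at most one point of a packing, so a large packing contains
many points far from `A`. -/
theorem HasPacking.exists_far_subset {k n : ℕ} {δ : ℝ} {T A : Finset X}
    (h : HasPacking k δ T) (hA : #A + n ≤ k) :
    ∃ B ⊆ T, #B = n ∧ (∀ x ∈ B, ∀ y ∈ B, x ≠ y → δ ≤ dist x y) ∧
      ∀ x ∈ B, ∀ a ∈ A, δ / 2 ≤ dist x a := by
  obtain ⟨G, hGT, hGk, hsep⟩ := h
  have hclose : #{x ∈ G | ¬ ∀ a ∈ A, δ / 2 ≤ dist x a} ≤ #A := by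
    have hex : ∀ x ∈ ({x ∈ G | ¬ ∀ a ∈ A, δ / 2 ≤ dist x a} : Finset X),
        ∃ a ∈ A, dist x a < δ / 2 := by
      intro x hx
      have := (mem_filter.1 hx).2
      push Not at this
      exact this
    choose! g hgA hgd using hex
    refine card_le_card_of_injOn g (fun x hx => hgA x hx) fun x hx y hy hxy => ?_
    by_contra hne
    have h1 := hsep x (mem_filter.1 hx).1 y (mem_filter.1 hy).1 hne
    have h2 := hgd x hx
    have h3 := hgd y hy
    rw [← hxy] at h3
    have := dist_triangle_right x y (g x)
    linarith
  have hsplit := card_filter_add_card_filter_not (s := G) (fun x => ∀ a ∈ A, δ / 2 ≤ dist x a)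
  obtain ⟨B, hB, hBn⟩ := exists_subset_card_eq
    (s := {x ∈ G | ∀ a ∈ A, δ / 2 ≤ dist x a}) (n := n) (by omega)
  have hBG : B ⊆ G := hB.trans (filter_subset _ _)
  exact ⟨B, hBG.trans hGT, hBn, fun x hx y hy => hsep x (hBG hx) y (hBG hy),
    fun x hx => (mem_filter.1 (hB hx)).2⟩

/-- A partial selection that is empty on the colors `F` can be extended to these colors by points
that are far from all other selected points, if all these colors have packings. -/
theorem exists_selection_extension {m k : ℕ} {κ : Fin m → ℕ} (hk : k = ∑ i, κ i) {δ : ℝ}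
    (hδ : 0 < δ) {T S₀ : Fin m → Finset X} (hS₀ : ∀ i, #(S₀ i) ≤ κ i) (F : Finset (Fin m))
    (hF : ∀ i ∈ F, HasPacking k δ (T i)) (hF₀ : ∀ i ∈ F, S₀ i = ∅) :
    ∃ S : Fin m → Finset X, (∀ i ∉ F, S i = S₀ i) ∧
      ∀ i ∈ F, S i ⊆ T i ∧ #(S i) = κ i ∧
        ∀ x ∈ S i, ∀ l, ∀ y ∈ S l, x ≠ y → δ / 2 ≤ dist x y := by
  induction F using Finset.induction_on with
  | empty => exact ⟨S₀, by simp⟩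
  | insert a F ha ih =>
    obtain ⟨S, hS, hSF⟩ := ih (fun i hi => hF i (mem_insert_of_mem hi))
      (fun i hi => hF₀ i (mem_insert_of_mem hi))
    have hSa : S a = ∅ := by rw [hS a ha, hF₀ a (mem_insert_self _ _)]
    have hcard : ∀ i, #(S i) ≤ κ i := by
      intro i
      by_cases hi : i ∈ F
      · exact (hSF i hi).2.1.le
      · rw [hS i hi]; exact hS₀ i
    have hA : #(univ.biUnion S) + κ a ≤ k := by
      have h1 : #(univ.biUnion S) ≤ ∑ i, #(S i) := card_biUnion_le
      have h2 : ∑ i, #(S i) = ∑ i ∈ univ.erase a, #(S i) := by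
        rw [← add_sum_erase _ _ (mem_univ a), hSa]; simp
      have h3 : ∑ i ∈ univ.erase a, #(S i) ≤ ∑ i ∈ univ.erase a, κ i :=
        sum_le_sum fun i _ => hcard i
      have h4 := add_sum_erase univ κ (mem_univ a)
      omega
    obtain ⟨B, hBT, hBc, hBsep, hBA⟩ := (hF a (mem_insert_self _ _)).exists_far_subset hA
    have hfar : ∀ x ∈ B, ∀ l, ∀ y ∈ S l, δ / 2 ≤ dist x y := fun x hx l y hy =>
      hBA x hx y (mem_biUnion.2 ⟨l, mem_univ l, hy⟩)
    refine ⟨Function.update S a B, fun i hi => ?_, fun i hi => ?_⟩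
    · rw [mem_insert, not_or] at hi
      rw [Function.update_of_ne hi.1, hS i hi.2]
    · rcases eq_or_ne i a with rfl | hia
      · rw [Function.update_self]
        refine ⟨hBT, hBc, fun x hx l y hy hxy => ?_⟩
        rcases eq_or_ne l i with rfl | hl
        · rw [Function.update_self] at hy
          have := hBsep x hx y hy hxy
          linarith
        · rw [Function.update_of_ne hl] at hy
          exact hfar x hx l y hy
      · obtain ⟨h1, h2, h3⟩ := hSF i ((mem_insert.1 hi).resolve_left hia)
        rw [Function.update_of_ne hia]
        refine ⟨h1, h2, fun x hx l y hy hxy => ?_⟩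
        rcases eq_or_ne l a with rfl | hl
        · rw [Function.update_self] at hy
          rw [dist_comm]
          exact hfar y hy i x hx
        · rw [Function.update_of_ne hl] at hy
          exact h3 x hx l y hy hxy

end Selection

section Averaging

/-- A weak-type bound on `f` bounds its sum, with a harmonic loss. -/
theorem sum_le_mul_harmonic_of_card_mul_le {ι : Type*} [DecidableEq ι] (s : Finset ι) (f : ι → ℝ)
    {M : ℝ} (h : ∀ r, (#{x ∈ s | r ≤ f x} : ℝ) * r ≤ M) :
    ∑ x ∈ s, f x ≤ M * (harmonic #s : ℝ) := by
  have hM : 0 ≤ M := by simpa using h 0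
  induction hn : #s generalizing s with
  | zero => simp [card_eq_zero.1 hn]
  | succ n ih =>
    have hne : s.Nonempty := card_pos.1 (by omega)
    obtain ⟨x, hx, hmin⟩ := s.exists_min_image f hne
    have hxM : f x ≤ M * ((n : ℝ) + 1)⁻¹ := by
      have := h (f x)
      rw [filter_true_of_mem hmin, hn] at this
      rw [← div_eq_mul_inv, le_div_iff₀ (by positivity), mul_comm]
      exact_mod_cast this
    have hrest : ∑ y ∈ s.erase x, f y ≤ M * (harmonic n : ℝ) := by
      refine ih _ (fun r => ?_) (by rw [card_erase_of_mem hx, hn]; rfl)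
      rcases le_total r 0 with hr | hr
      · exact (mul_nonpos_of_nonneg_of_nonpos (by positivity) hr).trans hM
      · refine le_trans ?_ (h r)
        gcongr
        exact erase_subset _ _
    rw [← add_sum_erase _ _ hx, harmonic_succ]
    push_cast
    linarith

theorem harmonic_le_three_mul_log {k : ℕ} (hk : 2 ≤ k) : (harmonic k : ℝ) ≤ 3 * Real.log k := by
  have h1 := harmonic_le_one_add_log k
  have h2 : Real.log 2 ≤ Real.log k :=
    Real.log_le_log (by norm_num) (by exact_mod_cast hk)
  have h3 := Real.log_two_gt_d9
  linarith

end Averaging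

section Main

theorem IsFairSelection.card_biUnion {X : Type*} [DecidableEq X] {m : ℕ} {κ : Fin m → ℕ}
    {P S : Fin m → Finset X}
    (hS : IsFairSelection κ P S) (hP : Pairwise fun i j => Disjoint (P i) (P j)) :
    #(univ.biUnion S) = ∑ i, κ i := by
  rw [Finset.card_biUnion fun i _ j _ hij => (hP hij).mono (hS i).1 (hS j).1]
  exact sum_congr rfl fun i _ => (hS i).2

variable {X : Type*} [MetricSpace X] [DecidableEq X]

theorem sumNN_nonneg (S : Finset X) : 0 ≤ sumNN S :=
  sum_nonneg fun _ _ => Metric.infDist_nonneg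

theorem card_mul_le_sumNN (S : Finset X) (r : ℝ) :
    (#{p ∈ S | r ≤ Metric.infDist p (S.erase p : Set X)} : ℝ) * r ≤ sumNN S := by
  rw [← nsmul_eq_mul]
  refine (card_nsmul_le_sum _ _ r fun p hp => (mem_filter.1 hp).2).trans ?_
  exact sum_le_sum_of_subset_of_nonneg (filter_subset _ _) fun _ _ _ => Metric.infDist_nonneg

/-- The core-sets contain a fair selection that has, up to constants, as many points with large
nearest-neighbor distance as a given fair selection from the data. -/
theorem exists_fairSelection_card_le {m k : ℕ} {κ : Fin m → ℕ} (hk : k = ∑ i, κ i) (hk2 : 2 ≤ k)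
    {P T O : Fin m → Finset X} (hP : Pairwise fun i j => Disjoint (P i) (P j))
    (hT : ∀ i, SumNNCoresetAlg k (P i) (T i)) (hO : IsFairSelection κ P O) {r : ℝ} (hr : 0 < r) :
    ∃ S, IsFairSelection κ T S ∧
      #{p ∈ univ.biUnion O | r ≤ Metric.infDist p ((univ.biUnion O).erase p : Set X)} ≤
      #{p ∈ univ.biUnion S | r / 8 ≤ Metric.infDist p ((univ.biUnion S).erase p : Set X)} := by
  classical
  have hκ : ∀ i, κ i ≤ k := fun i => hk ▸ single_le_sum (fun _ _ => Nat.zero_le _) (mem_univ i)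
  have hδ : 0 < r / 4 := by positivity
  have hmove : ∀ i, ∃ f : X → X, ¬ HasPacking k (r / 4) (T i) →
      Set.InjOn f (O i) ∧ ∀ p ∈ O i, f p ∈ T i ∧ dist p (f p) < r / 4 := by
    intro i
    rcases (hT i).hasPacking_or_exists_injOn hδ with h | h
    · exact ⟨id, fun h' => absurd h h'⟩
    · obtain ⟨f, hf⟩ := h (O i) (hO i).1 ((hO i).2.trans_le (hκ i))
      exact ⟨f, fun _ => hf⟩
  choose f hf using hmove
  obtain ⟨S, hS₀, hSF⟩ := exists_selection_extension (κ := κ) hk hδ (T := T)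
    (S₀ := fun i => if HasPacking k (r / 4) (T i) then ∅ else (O i).image (f i))
    (fun i => by
      split_ifs
      · simp
      · exact card_image_le.trans (hO i).2.le)
    {i | HasPacking k (r / 4) (T i)} (fun i hi => (mem_filter.1 hi).2)
    (fun i hi => if_pos (mem_filter.1 hi).2)
  have hthin : ∀ i, ¬ HasPacking k (r / 4) (T i) → S i = (O i).image (f i) := fun i hi => by
    rw [hS₀ i (by simpa using hi), if_neg hi]
  have hfat : ∀ i, HasPacking k (r / 4) (T i) → S i ⊆ T i ∧ #(S i) = κ i ∧
      ∀ x ∈ S i, ∀ l, ∀ y ∈ S l, x ≠ y → r / 4 / 2 ≤ dist x y := fun i hi =>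
    hSF i (by simpa using hi)
  have hS : IsFairSelection κ T S := by
    intro i
    by_cases hi : HasPacking k (r / 4) (T i)
    · exact ⟨(hfat i hi).1, (hfat i hi).2.1⟩
    · rw [hthin i hi]
      exact ⟨image_subset_iff.2 fun p hp => ((hf i hi).2 p hp).1,
        by rw [card_image_of_injOn (hf i hi).1, (hO i).2]⟩
  have hTdisj : Pairwise fun i j => Disjoint (T i) (T j) := fun i j hij =>
    (hP hij).mono (hT i).subset (hT j).subset
  have hScard : 2 ≤ #(univ.biUnion S) := by rw [hS.card_biUnion hTdisj, ← hk]; exact hk2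
  have hgood : ∀ i, ∀ x ∈ S i, (∀ l, ∀ y ∈ S l, x ≠ y → r / 8 ≤ dist x y) →
      r / 8 ≤ Metric.infDist x ((univ.biUnion S).erase x : Set X) := by
    intro i x hx h
    refine (Metric.le_infDist ?_).2 fun {y} hy => ?_
    · have hxU : x ∈ univ.biUnion S := mem_biUnion.2 ⟨i, mem_univ i, hx⟩
      have : 0 < #((univ.biUnion S).erase x) := by rw [card_erase_of_mem hxU]; omega
      have hne := card_pos.1 this
      exact_mod_cast hne
    · rw [mem_coe, mem_erase, mem_biUnion] at hy
      obtain ⟨hne, l, -, hyl⟩ := hy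
      exact h l y hyl hne.symm
  refine ⟨S, hS, ?_⟩
  rw [filter_biUnion, filter_biUnion, Finset.card_biUnion (t := fun i =>
    {p ∈ S i | r / 8 ≤ Metric.infDist p ((univ.biUnion S).erase p : Set X)})]
  · refine card_biUnion_le.trans (sum_le_sum fun i _ => ?_)
    by_cases hi : HasPacking k (r / 4) (T i)
    · obtain ⟨-, hc, hsep⟩ := hfat i hi
      rw [filter_true_of_mem (s := S i), hc]
      · exact (card_filter_le _ _).trans (hO i).2.le
      · intro x hx
        refine hgood i x hx fun l y hy hxy => ?_
        have := hsep x hx l y hy hxy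
        linarith
    · refine card_le_card_of_injOn (f i) (fun p hp => ?_)
        ((hf i hi).1.mono fun p hp => (mem_filter.1 hp).1)
      obtain ⟨hpO, hpr⟩ := mem_filter.1 hp
      have hfp : f i p ∈ S i := by rw [hthin i hi]; exact mem_image_of_mem _ hpO
      refine mem_filter.2 ⟨hfp, hgood i _ hfp fun l y hy hxy => ?_⟩
      by_cases hl : HasPacking k (r / 4) (T l)
      · have := (hfat l hl).2.2 y hy i _ hfp hxy.symm
        rw [dist_comm]
        linarith
      · rw [hthin l hl] at hy
        obtain ⟨q, hq, rfl⟩ := mem_image.1 hy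
        have hpq : q ≠ p := by
          rintro rfl
          rcases eq_or_ne i l with rfl | hil
          · exact hxy rfl
          · exact disjoint_left.1 (hP hil) ((hO i).1 hpO) ((hO l).1 hq)
        have hd : r ≤ dist p q := hpr.trans (Metric.infDist_le_dist_of_mem (by
          rw [mem_coe]
          exact mem_erase.2 ⟨hpq, mem_biUnion.2 ⟨l, mem_univ l, hq⟩⟩))
        have h1 := ((hf i hi).2 p hpO).2
        have h2 := ((hf l hl).2 q hq).2
        have h3 := dist_triangle4 p (f i p) (f l q) q
        rw [dist_comm (f l q) q] at h3
        linarith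
  · intro i _ j _ hij
    exact (hTdisj hij).mono ((filter_subset _ _).trans (hS i).1)
      ((filter_subset _ _).trans (hS j).1)

/-- The core-sets lose only a factor `O(log k)`, for any number of colors. -/
theorem fairDiv_le_log_mul_fairDiv {m k : ℕ} {κ : Fin m → ℕ} (hk : k = ∑ i, κ i) (hk2 : 2 ≤ k)
    {P T : Fin m → Finset X} (hP : Pairwise fun i j => Disjoint (P i) (P j))
    (hκP : ∀ i, κ i ≤ #(P i)) (hκT : ∀ i, κ i ≤ #(T i))
    (hT : ∀ i, SumNNCoresetAlg k (P i) (T i)) :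
    0 ≤ fairDiv κ T ∧ fairDiv κ P ≤ 24 * Real.log k * fairDiv κ T := by
  obtain ⟨⟨S, -, hSv⟩, hmax⟩ := isGreatest_fairDiv κ T hκT
  have h0 : 0 ≤ fairDiv κ T := hSv ▸ sumNN_nonneg _
  refine ⟨h0, ?_⟩
  obtain ⟨⟨O, hO, hOv⟩, -⟩ := isGreatest_fairDiv κ P hκP
  have hsum : sumNN (univ.biUnion O) ≤
      8 * fairDiv κ T * (harmonic #(univ.biUnion O) : ℝ) := by
    refine sum_le_mul_harmonic_of_card_mul_le _ _ fun r => ?_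
    rcases le_or_gt r 0 with hr | hr
    · exact (mul_nonpos_of_nonneg_of_nonpos (by positivity) hr).trans (by positivity)
    obtain ⟨S, hS, hcard⟩ := exists_fairSelection_card_le hk hk2 hP hT hO hr
    have h1 := card_mul_le_sumNN (univ.biUnion S) (r / 8)
    have h2 := hmax ⟨S, hS, rfl⟩
    have h3 := mul_le_mul_of_nonneg_right (Nat.cast_le (α := ℝ).2 hcard)
      (show 0 ≤ r / 8 by positivity)
    linarith
  rw [hO.card_biUnion hP, ← hk, ← hOv] at hsum
  have := mul_le_mul_of_nonneg_left (harmonic_le_three_mul_log hk2)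
    (show 0 ≤ 8 * fairDiv κ T by positivity)
  linarith

end Main

theorem mainTheorem5 :
    ∃ C : ℝ, 0 < C ∧
      ∀ (X : Type*) [MetricSpace X] [DecidableEq X] (m : ℕ) (κ : Fin m → ℕ) (k : ℕ),
        k = ∑ i, κ i → 2 ≤ k →
          IsColorAbidingComposableCoreset (X := X) (SumNNCoresetAlg k) κ
              (C * (m * Real.log k)) ∧
            ∀ Q T : Finset X, SumNNCoresetAlg k Q T → (#T : ℝ) ≤ C * (k : ℝ) ^ 2 := by
  refine ⟨24, by norm_num, ?_⟩
  intro X _ _ m κ k hk hk2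
  have hk2' : (2 : ℝ) ≤ k := by exact_mod_cast hk2
  refine ⟨⟨fun Q => ?_, fun Q T h => h.subset, fun P hP hκP T hT => ?_⟩, fun Q T h => ?_⟩
  · obtain ⟨T, Q', h⟩ := exists_repeatedGMM k Q k
    exact ⟨T, Q', h⟩
  · have hκk : ∀ i, κ i ≤ k := fun i =>
      hk ▸ single_le_sum (fun _ _ => Nat.zero_le _) (mem_univ i)
    have hκT : ∀ i, κ i ≤ #(T i) := fun i => (hT i).le_card (hκk i) (hκP i)
    refine ⟨hκT, ?_⟩
    obtain ⟨h0, hle⟩ := fairDiv_le_log_mul_fairDiv hk hk2 hP hκP hκT hT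
    have hm : (1 : ℝ) ≤ m := by
      have : m ≠ 0 := by
        rintro rfl
        simp at hk
        omega
      exact_mod_cast Nat.one_le_iff_ne_zero.2 this
    have hlog : 0 < Real.log k := Real.log_pos (by linarith)
    rw [one_div_mul_eq_div, div_le_iff₀ (by positivity)]
    have h1 : Real.log k ≤ m * Real.log k := le_mul_of_one_le_left hlog.le hm
    have h2 := mul_le_mul_of_nonneg_right h1 h0
    linarith
  · obtain ⟨Q', hQ'⟩ := h
    have h1 : (#T : ℝ) ≤ k * (k + 1) := by exact_mod_cast hQ'.card_le
    nlinarith
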